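/- Let $n,p$ be integers with $n-p-1>0$, let $M\in\mathbb{R}^{n\times p}$, and let $X\in\mathbb{R}^{n\times p}$ be a random matrix with independent entries $X_{ij}\sim \mathrm{N}(M_{ij},1)$. Let $$\hat M_{\mathrm{EM}} = X\bigl(I_p-(n-p-1)(X^\top X)^{-1}\bigr)$$ be the Efron--Morris estimator and let $$R(M)=\mathrm{E}_M\bigl[(\hat M_{\mathrm{EM}}-M)^\top(\hat M_{\mathrm{EM}}-M)\bigr]\in\mathbb{R}^{p\times p}$$ be its matrix quadratic risk (the expectation is taken entrywise). Then the expectation is finite, and $R(M)$ has the same eigenvectors as $M^\top M$ in the following sense: for every spectral decomposition $M^\top M=U^\top\Lambda U$ with $U$ orthogonal and $\Lambda=\mathrm{diag}(\lambda_1,\dots,\lambda_p)$, there are real numbers $\rho_1,\dots,\rho_p$ with $$R(M)=U^\top\,\mathrm{diag}(\rho_1,\dots,\rho_p)\,U ,$$ and $\rho_j=p+1$ for every $j$ with $\lambda_j=0$. In particular, every eigenvector $v$ of $M^\top M$ is an eigenvector of $R(M)$, and if $M^\top M v=0$, then $R(M)v=(p+1)v$. -/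

import Mathlib

open MeasureTheory ProbabilityTheory Matrix

noncomputable section

namespace EfronMorris

/-- `X` is a random `n × p` matrix whose entries are independent with `X i j ∼ N(M i j, 1)`. -/
structure IsNormalMatrixObservation {Ω : Type*} [MeasurableSpace Ω] {n p : ℕ}
    (P : Measure Ω) (M : Matrix (Fin n) (Fin p) ℝ) (X : Ω → Matrix (Fin n) (Fin p) ℝ) :
    Prop where
  hasLaw : ∀ i j, HasLaw (fun ω => X ω i j) (gaussianReal (M i j) 1) P
  indep : iIndepFun (fun (ij : Fin n × Fin p) (ω : Ω) => X ω ij.1 ij.2) P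

/-- The Efron–Morris estimator `X (I - (n - p - 1) (XᵀX)⁻¹)`. -/
def estimator {n p : ℕ} (X : Matrix (Fin n) (Fin p) ℝ) : Matrix (Fin n) (Fin p) ℝ :=
  X * (1 - ((n : ℝ) - (p : ℝ) - 1) • (Xᵀ * X)⁻¹)

/-- The matrix quadratic loss `(M' - M)ᵀ (M' - M)` of the estimate `M'` of `M`. -/
def loss {n p : ℕ} (M M' : Matrix (Fin n) (Fin p) ℝ) : Matrix (Fin p) (Fin p) ℝ :=
  (M' - M)ᵀ * (M' - M)

/-- The matrix quadratic risk of the estimator `δ` of `M` based on the observation `X`: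
the entrywise expectation of the matrix quadratic loss. -/
def risk {Ω : Type*} [MeasurableSpace Ω] {n p : ℕ} (P : Measure Ω)
    (M : Matrix (Fin n) (Fin p) ℝ) (X : Ω → Matrix (Fin n) (Fin p) ℝ)
    (δ : Matrix (Fin n) (Fin p) ℝ → Matrix (Fin n) (Fin p) ℝ) : Matrix (Fin p) (Fin p) ℝ :=
  Matrix.of fun a b => ∫ ω, loss M (δ (X ω)) a b ∂P

end EfronMorris

end

/-! The eigenvectors come from symmetry. For orthogonal `O`, `Q` the matrix `O X Q` is again a
normal observation, with mean `O M Q`, and the estimator is equivariant, so R(OMQ) = Qᵀ R(M) Q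
(`risk_mul_mul`). If MᵀM u = c u with u ≠ 0, the reflections H along u and H' along M u satisfy H' M
H = M (`householder_mul_mul_householder`). Hence R(M) commutes with H and preserves its
(-1)-eigenspace, which is the line of u.

For the value p + 1, suppose M u = 0 with u a unit vector, and rotate u to a coordinate vector e_a,
so that column a has mean zero. With c = n - p - 1, expanding the loss gives R_aa = n - 2c + c²
E[(XᵀX)⁻¹_aa]. Here (XᵀX)⁻¹_aa is the inverse squared distance from column a to the span of the
other columns (`ofReal_inv_gram_apply_self`). Given those columns, the squared distance is
chi-square with k = n - p + 1 degrees of freedom, whose inverse has mean 1/(k - 2) = 1/c. So R_aa =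
n - c = p + 1.

For a general mean the same expectation is at most 1/c. This puts the entries of X(XᵀX)⁻¹ in L² and
makes the risk finite. -/

namespace EfronMorris

open Set Filter Topology

/-! ### Gaussian vectors under matrices with orthonormal rows -/

theorem pi_gaussianReal_map_mulVec {ι κ : Type*} [Fintype ι] [Fintype κ] [DecidableEq κ]
    (A : Matrix κ ι ℝ) (hA : A * Aᵀ = 1) (m : ι → ℝ) :
    (Measure.pi fun i => gaussianReal (m i) 1).map (fun x => A *ᵥ x) =
      Measure.pi fun k => gaussianReal ((A *ᵥ m) k) 1 := by
  have hmeas : Measurable fun x : ι → ℝ => A *ᵥ x :=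
    (Continuous.matrix_mulVec continuous_const continuous_id).measurable
  have : IsProbabilityMeasure
      ((Measure.pi fun i => gaussianReal (m i) 1).map (fun x => A *ᵥ x)) :=
    Measure.isProbabilityMeasure_map hmeas.aemeasurable
  rw [← charFun_eq_pi_iff]
  intro t
  have hL : charFun (((Measure.pi fun i => gaussianReal (m i) 1).map
      (fun x => A *ᵥ x)).map (WithLp.toLp 2)) t =
      charFun ((Measure.pi fun i => gaussianReal (m i) 1).map (WithLp.toLp 2))
        (WithLp.toLp 2 (Aᵀ *ᵥ (WithLp.ofLp t))) := by
    rw [Measure.map_map (by fun_prop) hmeas, charFun_apply, charFun_apply,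
      integral_map (by fun_prop) (by fun_prop), integral_map (by fun_prop) (by fun_prop)]
    refine integral_congr_ae (Eventually.of_forall fun x => ?_)
    have : inner ℝ (WithLp.toLp 2 (A *ᵥ x)) t =
        inner ℝ (WithLp.toLp 2 x) (WithLp.toLp 2 (Aᵀ *ᵥ (WithLp.ofLp t))) := by
      simp only [EuclideanSpace.inner_eq_star_dotProduct, star_trivial]
      rw [dotProduct_comm, dotProduct_comm _ x, mulVec_transpose, dotProduct_comm x,
        ← dotProduct_mulVec, dotProduct_comm]
    simp [this]
  rw [hL, charFun_pi]
  simp only [charFun_gaussianReal, ← Complex.exp_sum]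
  congr 1
  have h1 : ∑ i, (Aᵀ *ᵥ (WithLp.ofLp t)) i * m i = ∑ k, t k * (A *ᵥ m) k := by
    change (Aᵀ *ᵥ (WithLp.ofLp t)) ⬝ᵥ m = (WithLp.ofLp t) ⬝ᵥ (A *ᵥ m)
    rw [mulVec_transpose, dotProduct_mulVec]
  have h2 : ∑ i, (Aᵀ *ᵥ (WithLp.ofLp t)) i ^ 2 = ∑ k, t k ^ 2 := by
    simp only [sq]
    change (Aᵀ *ᵥ (WithLp.ofLp t)) ⬝ᵥ (Aᵀ *ᵥ (WithLp.ofLp t)) = (WithLp.ofLp t) ⬝ᵥ (WithLp.ofLp t)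
    rw [dotProduct_mulVec, vecMul_transpose, mulVec_mulVec, hA, one_mulVec]
  simp only [Finset.sum_sub_distrib, ← Finset.sum_div, ← Finset.sum_mul]
  have h1' := congrArg (fun x : ℝ => (x : ℂ)) h1
  have h2' := congrArg (fun x : ℝ => (x : ℂ)) h2
  push_cast at h1' h2' ⊢
  simp only [one_mul, h1', h2']

/-! ### Mean of the inverse of a chi-square variable -/

theorem integrable_exp_neg_mul_sq_gaussianReal (μ : ℝ) {t : ℝ} (ht : 0 ≤ t) :
    Integrable (fun x => Real.exp (-(t * x ^ 2))) (gaussianReal μ 1) := by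
  refine Integrable.of_bound (C := 1) (by fun_prop) (Eventually.of_forall fun x => ?_)
  rw [Real.norm_eq_abs, Real.abs_exp, Real.exp_le_one_iff]
  have := mul_nonneg ht (sq_nonneg x)
  linarith

theorem integral_exp_neg_mul_sq_gaussianReal (μ : ℝ) {t : ℝ} (ht : 0 ≤ t) :
    ∫ x, Real.exp (-(t * x ^ 2)) ∂gaussianReal μ 1 =
      (√(1 + 2 * t))⁻¹ * Real.exp (-(t * μ ^ 2 / (1 + 2 * t))) := by
  rw [integral_gaussianReal_eq_integral_smul one_ne_zero]
  have hpos : 0 < 1 + 2 * t := by linarith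
  -- Completing the square in `(x - μ)² / 2 + t x²` leaves a Gaussian density with mean `μ / (1 +
  -- 2t)` and variance `1 / (1 + 2t)`.
  set v : NNReal := ⟨(1 + 2 * t)⁻¹, by positivity⟩ with hv
  have hvc : (v : ℝ) = (1 + 2 * t)⁻¹ := rfl
  have hv0 : v ≠ 0 := by
    rw [← NNReal.coe_ne_zero, hvc]; positivity
  have key : ∀ x, gaussianPDFReal μ 1 x • Real.exp (-(t * x ^ 2)) =
      ((√(1 + 2 * t))⁻¹ * Real.exp (-(t * μ ^ 2 / (1 + 2 * t)))) *
        gaussianPDFReal (μ / (1 + 2 * t)) v x := by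
    intro x
    simp only [gaussianPDFReal, smul_eq_mul, hvc, NNReal.coe_one, mul_one]
    have e1 : √(2 * Real.pi * (1 + 2 * t)⁻¹) = √(2 * Real.pi) * (√(1 + 2 * t))⁻¹ := by
      rw [Real.sqrt_mul (by positivity), Real.sqrt_inv]
    have hs : √(1 + 2 * t) ≠ 0 := by positivity
    have hs2 : √(2 * Real.pi) ≠ 0 := by positivity
    rw [e1, mul_assoc, ← Real.exp_add]
    have e2 : (√(1 + 2 * t))⁻¹ * Real.exp (-(t * μ ^ 2 / (1 + 2 * t))) *
        ((√(2 * Real.pi) * (√(1 + 2 * t))⁻¹)⁻¹ *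
          Real.exp (-(x - μ / (1 + 2 * t)) ^ 2 / (2 * (1 + 2 * t)⁻¹))) =
        (√(2 * Real.pi))⁻¹ * Real.exp (-(t * μ ^ 2 / (1 + 2 * t)) +
          -(x - μ / (1 + 2 * t)) ^ 2 / (2 * (1 + 2 * t)⁻¹)) := by
      rw [Real.exp_add]
      field_simp
    rw [e2]
    congr 2
    field_simp
    ring
  simp_rw [key]
  rw [integral_const_mul, integral_gaussianPDFReal_eq_one _ hv0, mul_one]

/-- Working in `ENNReal` keeps `q = 0`, where both sides are `∞`; finiteness of a mean inverse then
shows that `q` is almost surely nonzero. -/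
theorem lintegral_Ioi_exp_neg_mul {q : ℝ} (hq : 0 ≤ q) :
    ∫⁻ t in Ioi (0 : ℝ), ENNReal.ofReal (Real.exp (-(t * q))) = (ENNReal.ofReal q)⁻¹ := by
  rcases hq.eq_or_lt with rfl | hq
  · simp
  · have hint : IntegrableOn (fun t : ℝ => Real.exp (-q * t)) (Ioi 0) :=
      integrableOn_exp_mul_Ioi (by linarith) 0
    have h : (fun t : ℝ => Real.exp (-(t * q))) = fun t => Real.exp (-q * t) := by
      ext t; congr 1; ring
    rw [← ofReal_integral_eq_lintegral_ofReal (by rw [h]; exact hint)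
      (Eventually.of_forall fun t => (Real.exp_pos _).le), h, integral_exp_mul_Ioi (by linarith),
      ← ENNReal.ofReal_inv_of_pos hq]
    simp

theorem lintegral_Ioi_inv_sqrt_pow {k : ℕ} (hk : 3 ≤ k) :
    ∫⁻ t in Ioi (0 : ℝ), ENNReal.ofReal ((√(1 + 2 * t))⁻¹ ^ k) =
      ENNReal.ofReal (1 / ((k : ℝ) - 2)) := by
  have hk' : (3 : ℝ) ≤ k := by exact_mod_cast hk
  set F : ℝ → ℝ := fun t => -(1 + 2 * t) ^ (1 - (k : ℝ) / 2) / ((k : ℝ) - 2) with hF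
  have hd : ∀ t ∈ Ici (0 : ℝ), HasDerivAt F ((√(1 + 2 * t))⁻¹ ^ k) t := by
    intro t ht
    have ht' : 0 < 1 + 2 * t := by have : (0 : ℝ) ≤ t := ht; linarith
    have h1 : HasDerivAt (fun t : ℝ => 1 + 2 * t) 2 t := by
      simpa using ((hasDerivAt_id t).const_mul 2).const_add 1
    have h2 := ((h1.rpow_const (p := 1 - (k : ℝ) / 2) (Or.inl ht'.ne')).neg).div_const ((k : ℝ) - 2)
    refine h2.congr_deriv ?_
    have e : (√(1 + 2 * t))⁻¹ ^ k = (1 + 2 * t) ^ (1 - (k : ℝ) / 2 - 1) := by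
      rw [Real.sqrt_eq_rpow, ← Real.rpow_neg ht'.le, ← Real.rpow_natCast, ← Real.rpow_mul ht'.le]
      congr 1; ring
    rw [e]
    have : (k : ℝ) - 2 ≠ 0 := by linarith
    field_simp
    ring
  have htend : Tendsto F atTop (𝓝 0) := by
    have h1 : Tendsto (fun t : ℝ => 1 + 2 * t) atTop atTop :=
      tendsto_atTop_add_const_left _ _ (tendsto_id.const_mul_atTop (by norm_num))
    have h2 := (tendsto_rpow_neg_atTop (y := (k : ℝ) / 2 - 1) (by linarith)).comp h1
    have h3 := (h2.neg).div_const ((k : ℝ) - 2)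
    simp only [neg_zero, zero_div] at h3
    refine h3.congr fun t => ?_
    simp only [hF, Function.comp]
    rw [show -((k : ℝ) / 2 - 1) = 1 - (k : ℝ) / 2 by ring]
  have hnn : ∀ t ∈ Ioi (0 : ℝ), 0 ≤ (√(1 + 2 * t))⁻¹ ^ k := fun t _ => by positivity
  have hcont : ContinuousWithinAt F (Ici 0) 0 :=
    (hd 0 (mem_Ici.2 le_rfl)).continuousAt.continuousWithinAt
  have hd' : ∀ t ∈ Ioi (0 : ℝ), HasDerivAt F ((√(1 + 2 * t))⁻¹ ^ k) t :=
    fun t ht => hd t (mem_Ici.2 (le_of_lt ht))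
  have hint := integrableOn_Ioi_deriv_of_nonneg hcont hd' hnn htend
  have hval := integral_Ioi_of_hasDerivAt_of_nonneg hcont hd' hnn htend
  rw [← ofReal_integral_eq_lintegral_ofReal hint
    ((ae_restrict_iff' measurableSet_Ioi).2 (Eventually.of_forall hnn)), hval]
  simp [hF]
  congr 1
  rw [neg_div, neg_neg, one_div]

/-- The Laplace representation of `1/q` and Tonelli turn the mean into an integral of products of
one-dimensional Gaussian transforms. -/
theorem lintegral_inv_sum_sq_eq {ι : Type*} [Fintype ι] (μ : ι → ℝ) :
    ∫⁻ y, (ENNReal.ofReal (∑ i, y i ^ 2))⁻¹ ∂(Measure.pi fun i => gaussianReal (μ i) 1) =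
      ∫⁻ t in Ioi (0 : ℝ), ENNReal.ofReal
        ((√(1 + 2 * t))⁻¹ ^ Fintype.card ι * Real.exp (-(t * (∑ i, μ i ^ 2) / (1 + 2 * t)))) := by
  have h1 : ∀ y : ι → ℝ, (ENNReal.ofReal (∑ i, y i ^ 2))⁻¹ =
      ∫⁻ t in Ioi (0 : ℝ), ENNReal.ofReal (Real.exp (-(t * ∑ i, y i ^ 2))) := fun y =>
    (lintegral_Ioi_exp_neg_mul (Finset.sum_nonneg fun i _ => sq_nonneg _)).symm
  simp_rw [h1]
  rw [lintegral_lintegral_swap (by fun_prop)]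
  refine setLIntegral_congr_fun measurableSet_Ioi fun t ht => ?_
  have ht0 : (0 : ℝ) ≤ t := le_of_lt ht
  have hexp : ∀ y : ι → ℝ, Real.exp (-(t * ∑ i, y i ^ 2)) = ∏ i, Real.exp (-(t * y i ^ 2)) := by
    intro y
    rw [← Real.exp_sum, Finset.mul_sum, Finset.sum_neg_distrib]
  simp_rw [hexp]
  rw [← ofReal_integral_eq_lintegral_ofReal
    (Integrable.fintype_prod fun i => integrable_exp_neg_mul_sq_gaussianReal (μ i) ht0)
    (Eventually.of_forall fun y => Finset.prod_nonneg fun i _ => (Real.exp_pos _).le),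
    integral_fintype_prod_eq_prod (f := fun _ x => Real.exp (-(t * x ^ 2)))]
  congr 1
  simp_rw [integral_exp_neg_mul_sq_gaussianReal _ ht0, Finset.prod_mul_distrib, ← Real.exp_sum]
  rw [Finset.prod_const, Finset.card_univ, Finset.sum_neg_distrib, Finset.mul_sum, Finset.sum_div]

/-- The means enter only through an exponential factor at most 1, so the central case is the worst
one. -/
theorem lintegral_inv_sum_sq_le {ι : Type*} [Fintype ι] (hι : 3 ≤ Fintype.card ι) (μ : ι → ℝ) :
    ∫⁻ y, (ENNReal.ofReal (∑ i, y i ^ 2))⁻¹ ∂(Measure.pi fun i => gaussianReal (μ i) 1) ≤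
      ENNReal.ofReal (1 / ((Fintype.card ι : ℝ) - 2)) := by
  rw [lintegral_inv_sum_sq_eq, ← lintegral_Ioi_inv_sqrt_pow hι]
  refine setLIntegral_mono (by fun_prop) fun t ht => ENNReal.ofReal_le_ofReal ?_
  have ht0 : (0 : ℝ) < t := ht
  refine mul_le_of_le_one_right (by positivity) (Real.exp_le_one_iff.2 ?_)
  have : 0 ≤ t * (∑ i, μ i ^ 2) / (1 + 2 * t) :=
    div_nonneg (mul_nonneg ht0.le (Finset.sum_nonneg fun i _ => sq_nonneg _)) (by linarith)
  linarith

theorem lintegral_inv_sum_sq_zero {ι : Type*} [Fintype ι] (hι : 3 ≤ Fintype.card ι) :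
    ∫⁻ y, (ENNReal.ofReal (∑ i : ι, y i ^ 2))⁻¹ ∂(Measure.pi fun _ => gaussianReal 0 1) =
      ENNReal.ofReal (1 / ((Fintype.card ι : ℝ) - 2)) := by
  rw [lintegral_inv_sum_sq_eq (fun _ : ι => 0), ← lintegral_Ioi_inv_sqrt_pow hι]
  simp

/-! ### Projections of Gaussian vectors and almost sure independence of columns -/

theorem lintegral_inv_norm_sq_starProjection_eq {ι : Type*} [Fintype ι]
    (K : Submodule ℝ (EuclideanSpace ℝ ι)) (m : ι → ℝ) :
    ∃ A : Matrix (Fin (Module.finrank ℝ K)) ι ℝ,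
      ∫⁻ x, (ENNReal.ofReal (‖K.starProjection (WithLp.toLp 2 x)‖ ^ 2))⁻¹
          ∂(Measure.pi fun i => gaussianReal (m i) 1) =
        ∫⁻ y, (ENNReal.ofReal (∑ i, y i ^ 2))⁻¹
          ∂(Measure.pi fun i => gaussianReal ((A *ᵥ m) i) 1) := by
  -- The rows of `A` are an orthonormal basis of `K`: `A x` lists the coordinates of the projection
  -- and again has independent unit-variance entries.
  let b := stdOrthonormalBasis ℝ K
  let A : Matrix (Fin (Module.finrank ℝ K)) ι ℝ := Matrix.of fun i j => (b i : EuclideanSpace ℝ ι) j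
  have hA : A * Aᵀ = 1 := by
    ext i j
    have h := orthonormal_iff_ite.1 b.orthonormal j i
    rw [Submodule.coe_inner, EuclideanSpace.inner_eq_star_dotProduct] at h
    simp only [star_trivial] at h
    have h' : (A * Aᵀ) i j = WithLp.ofLp (b i : EuclideanSpace ℝ ι) ⬝ᵥ
      WithLp.ofLp (b j : EuclideanSpace ℝ ι) := rfl
    rw [h', h, Matrix.one_apply]
    simp only [eq_comm]
  refine ⟨A, ?_⟩
  have hmeas : Measurable fun x : ι → ℝ => A *ᵥ x :=
    (Continuous.matrix_mulVec continuous_const continuous_id).measurable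
  rw [← pi_gaussianReal_map_mulVec A hA m, lintegral_map (by fun_prop) hmeas]
  refine lintegral_congr fun x => ?_
  congr 2
  rw [Submodule.starProjection_apply, ← Submodule.coe_norm, ← b.sum_sq_norm_inner_right]
  refine Finset.sum_congr rfl fun i _ => ?_
  rw [Submodule.inner_orthogonalProjectionOnto_eq_of_mem_left, Real.norm_eq_abs, sq_abs,
    EuclideanSpace.inner_eq_star_dotProduct, star_trivial, dotProduct_comm]
  rfl

theorem lintegral_inv_norm_sq_starProjection_le {ι : Type*} [Fintype ι]
    (K : Submodule ℝ (EuclideanSpace ℝ ι)) (hK : 3 ≤ Module.finrank ℝ K) (m : ι → ℝ) :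
    ∫⁻ x, (ENNReal.ofReal (‖K.starProjection (WithLp.toLp 2 x)‖ ^ 2))⁻¹
        ∂(Measure.pi fun i => gaussianReal (m i) 1) ≤
      ENNReal.ofReal (1 / ((Module.finrank ℝ K : ℝ) - 2)) := by
  obtain ⟨A, hA⟩ := lintegral_inv_norm_sq_starProjection_eq K m
  rw [hA]
  simpa using lintegral_inv_sum_sq_le (by simpa using hK) (A *ᵥ m)

theorem lintegral_inv_norm_sq_starProjection_zero {ι : Type*} [Fintype ι]
    (K : Submodule ℝ (EuclideanSpace ℝ ι)) (hK : 3 ≤ Module.finrank ℝ K) :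
    ∫⁻ x : ι → ℝ, (ENNReal.ofReal (‖K.starProjection (WithLp.toLp 2 x)‖ ^ 2))⁻¹
        ∂(Measure.pi fun _ => gaussianReal 0 1) =
      ENNReal.ofReal (1 / ((Module.finrank ℝ K : ℝ) - 2)) := by
  obtain ⟨A, hA⟩ := lintegral_inv_norm_sq_starProjection_eq K (0 : ι → ℝ)
  simp only [Pi.zero_apply] at hA
  rw [hA]
  simpa using lintegral_inv_sum_sq_zero (ι := Fin (Module.finrank ℝ K)) (by simpa using hK)

/-- The orthogonal complement of the span of the vectors `C j`. -/
noncomputable def spanCompl {ι κ : Type*} [Fintype ι] (C : κ → ι → ℝ) :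
    Submodule ℝ (EuclideanSpace ℝ ι) :=
  (Submodule.span ℝ (range fun j => WithLp.toLp 2 (C j)))ᗮ

theorem linearIndependent_toLp {ι κ : Type*} [Fintype ι] {C : κ → ι → ℝ}
    (hC : LinearIndependent ℝ C) :
    LinearIndependent ℝ fun j => (WithLp.toLp 2 (C j) : EuclideanSpace ℝ ι) :=
  hC.map' (WithLp.linearEquiv 2 ℝ (ι → ℝ)).symm.toLinearMap (LinearEquiv.ker _)

theorem finrank_spanCompl_add {ι κ : Type*} [Fintype ι] [Fintype κ] {C : κ → ι → ℝ}
    (hC : LinearIndependent ℝ C) :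
    Fintype.card κ + Module.finrank ℝ (spanCompl C) = Fintype.card ι := by
  rw [← finrank_span_eq_card (linearIndependent_toLp hC), spanCompl,
    Submodule.finrank_add_finrank_orthogonal, finrank_euclideanSpace]

/-- On the span the projection to the complement vanishes and its inverse square is `∞`; the mean of
that inverse is finite because the complement has dimension `n - q ≥ 3`. -/
theorem ae_notMem_span {n q : ℕ} (hq : q + 3 ≤ n) {C : Fin q → Fin n → ℝ}
    (hC : LinearIndependent ℝ C) (m : Fin n → ℝ) :
    ∀ᵐ x ∂(Measure.pi fun i => gaussianReal (m i) 1), x ∉ Submodule.span ℝ (range C) := by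
  have hrank := finrank_spanCompl_add hC
  simp only [Fintype.card_fin] at hrank
  have hlt := (lintegral_inv_norm_sq_starProjection_le (spanCompl C) (by omega) m).trans_lt
    ENNReal.ofReal_lt_top
  have hae := ae_lt_top (by fun_prop) hlt.ne
  filter_upwards [hae] with x hx hmem
  have hmem' : WithLp.toLp 2 x ∈ Submodule.span ℝ
      (range fun j => (WithLp.toLp 2 (C j) : EuclideanSpace ℝ (Fin n))) := by
    have := Submodule.mem_map_of_mem
      (f := (WithLp.linearEquiv 2 ℝ (Fin n → ℝ)).symm.toLinearMap) hmem
    rw [Submodule.map_span, ← range_comp] at this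
    exact this
  have h0 : (spanCompl C).starProjection (WithLp.toLp 2 x) = 0 := by
    rw [spanCompl, Submodule.starProjection_apply_eq_zero_iff]
    exact Submodule.le_orthogonal_orthogonal _ hmem'
  rw [h0] at hx
  simp at hx

theorem linearIndependent_insertNth {V : Type*} [AddCommGroup V] [Module ℝ V] {q : ℕ}
    (a : Fin (q + 1)) {x : V} {C : Fin q → V} (hC : LinearIndependent ℝ C)
    (hx : x ∉ Submodule.span ℝ (range C)) :
    LinearIndependent ℝ (a.insertNth x C : Fin (q + 1) → V) := by
  rw [← linearIndependent_equiv (finSuccEquiv' a).symm]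
  have h : (a.insertNth x C : Fin (q + 1) → V) ∘ (finSuccEquiv' a).symm =
      fun o => Option.casesOn' o x C := by
    funext o
    cases o <;> simp
  rw [h]
  exact hC.option hx

theorem ae_linearIndependent {n : ℕ} : ∀ {p : ℕ}, p + 1 < n → ∀ m : Fin p → Fin n → ℝ,
    ∀ᵐ C ∂(Measure.pi fun j => Measure.pi fun i => gaussianReal (m j i) 1),
      LinearIndependent ℝ C
  | 0, _, _ => Eventually.of_forall fun _ => linearIndependent_empty_type
  | q + 1, hq, m => by
    have hrest := ae_linearIndependent (p := q) (by omega) fun j => m (Fin.succAbove 0 j)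
    have hmp := (measurePreserving_piFinSuccAbove
      (fun j : Fin (q + 1) => Measure.pi fun i => gaussianReal (m j i) 1) 0).symm
    rw [← hmp.map_eq]
    have hmeas : MeasurableSet {C : Fin (q + 1) → Fin n → ℝ | LinearIndependent ℝ C} :=
      isOpen_setOfPred_linearIndependent.measurableSet
    rw [ae_map_iff hmp.measurable.aemeasurable hmeas]
    have hmeas' := hmp.measurable hmeas
    -- Fubini in swapped order: the other columns are fixed first, and the new one then almost
    -- surely avoids their span.
    refine (Measure.ae_prod_iff_ae_ae hmeas').2 ((Measure.ae_ae_comm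
      (p := fun x C => LinearIndependent ℝ ((MeasurableEquiv.piFinSuccAbove
        (fun _ : Fin (q + 1) => Fin n → ℝ) 0).symm (x, C))) hmeas').2 ?_)
    filter_upwards [hrest] with C hC
    filter_upwards [ae_notMem_span (by omega) hC (m 0)] with x hx
    exact linearIndependent_insertNth 0 hC hx

/-! ### Diagonal entries of the inverse Gram matrix -/

theorem isUnit_mul_transpose_self {ι κ : Type*} [Fintype ι] [Fintype κ] [DecidableEq κ]
    {C : Matrix κ ι ℝ} (hC : LinearIndependent ℝ C) : IsUnit (C * Cᵀ) := by
  have h := PosDef.mul_conjTranspose_self C (vecMul_injective_iff.2 hC)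
  rw [conjTranspose_eq_transpose_of_trivial] at h
  exact h.isUnit

/-- Let `u` be row `a` of `S⁻¹` times `C`, and `s = S⁻¹ a a`. Then `C u = e_a`, so `u` is orthogonal
to the other rows and `|u|² = s`, while `C a - s⁻¹ u` is a combination of the other rows. The
projection is therefore `s⁻¹ u`, of squared length `1/s`. -/
theorem ofReal_inv_gram_apply_self {ι : Type*} [Fintype ι] {q : ℕ}
    {C : Matrix (Fin (q + 1)) ι ℝ} (hC : LinearIndependent ℝ C) (a : Fin (q + 1)) :
    ENNReal.ofReal ((C * Cᵀ)⁻¹ a a) =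
      (ENNReal.ofReal (‖(spanCompl fun j => C (a.succAbove j)).starProjection
        (WithLp.toLp 2 (C a))‖ ^ 2))⁻¹ := by
  have hS : IsUnit (C * Cᵀ).det := (isUnit_iff_isUnit_det _).1 (isUnit_mul_transpose_self hC)
  set S := C * Cᵀ with hSdef
  have hpos : 0 < S⁻¹ a a := by
    have h := PosDef.mul_conjTranspose_self C (vecMul_injective_iff.2 hC)
    rw [conjTranspose_eq_transpose_of_trivial] at h
    exact h.inv.diag_pos
  set s := S⁻¹ a a with hs
  set u : ι → ℝ := S⁻¹ a ᵥ* C with hu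
  have hCu : C *ᵥ u = Pi.single a 1 := by
    have hsym : S⁻¹ a = S⁻¹ᵀ a := by
      rw [transpose_nonsing_inv, hSdef, transpose_mul, transpose_transpose]
    have h1 : S⁻¹ a = S⁻¹ *ᵥ Pi.single a 1 := by
      rw [mulVec_single_one, hsym]; rfl
    rw [hu, ← mulVec_transpose, mulVec_mulVec, ← hSdef, h1, mulVec_mulVec, mul_nonsing_inv _ hS,
      one_mulVec]
  have huu : u ⬝ᵥ u = s := by
    conv_lhs => rw [hu, ← dotProduct_mulVec, ← hu, hCu]
    simp [hs]
  have hproj : (spanCompl fun j => C (a.succAbove j)).starProjection (WithLp.toLp 2 (C a)) =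
      s⁻¹ • WithLp.toLp 2 u := by
    refine Submodule.eq_starProjection_of_mem_orthogonal'
      (K := spanCompl fun j => C (a.succAbove j)) (z := WithLp.toLp 2 (C a - s⁻¹ • u))
      ?_ ?_ ?_
    · refine Submodule.smul_mem _ _ ?_
      rw [spanCompl, Submodule.mem_orthogonal]
      intro w hw
      induction hw using Submodule.span_induction with
      | mem w hw =>
        obtain ⟨j, rfl⟩ := hw
        have := congrFun hCu (a.succAbove j)
        rw [Pi.single_eq_of_ne (Fin.succAbove_ne a j)] at this
        rw [EuclideanSpace.inner_eq_star_dotProduct, star_trivial, dotProduct_comm]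
        exact this
      | zero => simp
      | add x y _ _ hx hy => rw [inner_add_left, hx, hy, add_zero]
      | smul c x _ hx => rw [inner_smul_left, hx, mul_zero]
    · refine Submodule.le_orthogonal_orthogonal _ ?_
      have hexp : C a - s⁻¹ • u = ∑ j, (-(s⁻¹ * S⁻¹ a (a.succAbove j))) • C (a.succAbove j) := by
        have : u = ∑ b, S⁻¹ a b • C b := by
          rw [hu, vecMul_eq_sum]
        rw [this, Fin.sum_univ_succAbove _ a, ← hs, smul_add, smul_smul, inv_mul_cancel₀ hpos.ne',
          one_smul, Finset.smul_sum]
        simp only [neg_smul, Finset.sum_neg_distrib, smul_smul]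
        abel
      rw [hexp, WithLp.toLp_sum]
      refine Submodule.sum_mem _ fun j _ => ?_
      rw [WithLp.toLp_smul]
      exact Submodule.smul_mem _ _ (Submodule.subset_span ⟨j, rfl⟩)
    · rw [← WithLp.toLp_smul, ← WithLp.toLp_add]; simp
  rw [hproj, norm_smul, mul_pow, EuclideanSpace.real_norm_sq_eq]
  have huu' : ∑ i, u i ^ 2 = s := by rw [← huu]; simp [dotProduct, sq]
  simp only [huu']
  rw [← ENNReal.ofReal_inv_of_pos]
  · congr 1
    rw [Real.norm_eq_abs, sq_abs]
    field_simp
  · rw [Real.norm_eq_abs, sq_abs]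
    positivity

theorem measurable_inv_gram_apply {n p : ℕ} (a b : Fin p) :
    Measurable fun C : Fin p → Fin n → ℝ => ((Matrix.of C) * (Matrix.of C)ᵀ)⁻¹ a b := by
  simp only [inv_def, Matrix.smul_apply, smul_eq_mul, Ring.inverse_eq_inv']
  have hc : Continuous fun C : Fin p → Fin n → ℝ => (Matrix.of C) * (Matrix.of C)ᵀ :=
    Continuous.matrix_mul continuous_id (Continuous.matrix_transpose continuous_id)
  exact (hc.matrix_det.measurable.inv).mul (hc.matrix_adjugate.matrix_elem a b).measurable

/-- Conditioning on all vectors but the one at `a` reduces the matrix expectation to that of a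
projected Gaussian vector, on a space of dimension `n - q` almost surely. -/
theorem lintegral_inv_gram_apply_self_eq {n q : ℕ} (hq : q + 2 < n) (a : Fin (q + 1))
    (m : Fin (q + 1) → Fin n → ℝ) :
    ∫⁻ C, ENNReal.ofReal (((Matrix.of C) * (Matrix.of C)ᵀ)⁻¹ a a)
        ∂(Measure.pi fun j => Measure.pi fun i => gaussianReal (m j i) 1) =
      ∫⁻ C, ∫⁻ x, (ENNReal.ofReal (‖(spanCompl C).starProjection (WithLp.toLp 2 x)‖ ^ 2))⁻¹
        ∂(Measure.pi fun i => gaussianReal (m a i) 1)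
        ∂(Measure.pi fun j => Measure.pi fun i => gaussianReal (m (a.succAbove j) i) 1) := by
  have hmp := (measurePreserving_piFinSuccAbove
    (fun j : Fin (q + 1) => Measure.pi fun i => gaussianReal (m j i) 1) a).symm
  have hmeas : Measurable fun C : Fin (q + 1) → Fin n → ℝ =>
      ENNReal.ofReal (((Matrix.of C) * (Matrix.of C)ᵀ)⁻¹ a a) :=
    (measurable_inv_gram_apply a a).ennreal_ofReal
  rw [← hmp.lintegral_comp hmeas]
  refine (lintegral_prod_symm' _ (hmeas.comp hmp.measurable)).trans ?_
  refine lintegral_congr_ae ?_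
  filter_upwards [ae_linearIndependent (by omega) fun j => m (a.succAbove j)] with C hC
  refine lintegral_congr_ae ?_
  filter_upwards [ae_notMem_span (by omega) hC (m a)] with x hx
  have h := ofReal_inv_gram_apply_self (linearIndependent_insertNth a hC hx) a
  simp only [Fin.insertNth_apply_same, Fin.insertNth_apply_succAbove] at h
  exact h

theorem lintegral_inv_gram_apply_self_le {n q : ℕ} (hq : q + 2 < n) (a : Fin (q + 1))
    (m : Fin (q + 1) → Fin n → ℝ) :
    ∫⁻ C, ENNReal.ofReal (((Matrix.of C) * (Matrix.of C)ᵀ)⁻¹ a a)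
        ∂(Measure.pi fun j => Measure.pi fun i => gaussianReal (m j i) 1) ≤
      ENNReal.ofReal (1 / ((n : ℝ) - q - 2)) := by
  rw [lintegral_inv_gram_apply_self_eq hq a m]
  calc _ ≤ ∫⁻ _, ENNReal.ofReal (1 / ((n : ℝ) - q - 2)) ∂(Measure.pi fun j => Measure.pi fun i =>
          gaussianReal (m (a.succAbove j) i) 1) := by
        refine lintegral_mono_ae ?_
        filter_upwards [ae_linearIndependent (by omega) fun j => m (a.succAbove j)] with C hC
        have hrank := finrank_spanCompl_add hC
        simp only [Fintype.card_fin] at hrank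
        have h := lintegral_inv_norm_sq_starProjection_le (spanCompl C) (by omega) (m a)
        rwa [show (n : ℝ) - q = Module.finrank ℝ (spanCompl C) by
          rw [sub_eq_iff_eq_add']; exact_mod_cast hrank.symm]
    _ = _ := by simp

theorem lintegral_inv_gram_apply_self_of_eq_zero {n q : ℕ} (hq : q + 2 < n) (a : Fin (q + 1))
    (m : Fin (q + 1) → Fin n → ℝ) (hm : m a = 0) :
    ∫⁻ C, ENNReal.ofReal (((Matrix.of C) * (Matrix.of C)ᵀ)⁻¹ a a)
        ∂(Measure.pi fun j => Measure.pi fun i => gaussianReal (m j i) 1) =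
      ENNReal.ofReal (1 / ((n : ℝ) - q - 2)) := by
  rw [lintegral_inv_gram_apply_self_eq hq a m]
  calc _ = ∫⁻ _, ENNReal.ofReal (1 / ((n : ℝ) - q - 2)) ∂(Measure.pi fun j => Measure.pi fun i =>
          gaussianReal (m (a.succAbove j) i) 1) := by
        refine lintegral_congr_ae ?_
        filter_upwards [ae_linearIndependent (by omega) fun j => m (a.succAbove j)] with C hC
        have hrank := finrank_spanCompl_add hC
        simp only [Fintype.card_fin] at hrank
        have h := lintegral_inv_norm_sq_starProjection_zero (spanCompl C) (by omega)
        rw [show (n : ℝ) - q = Module.finrank ℝ (spanCompl C) by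
          rw [sub_eq_iff_eq_add']; exact_mod_cast hrank.symm]
        simpa only [hm, Pi.zero_apply] using h
    _ = _ := by simp

open scoped Kronecker

/-! ### The normal matrix observation, its risk and its orthogonal invariance -/

section Observation

variable {Ω : Type*} [MeasurableSpace Ω] {P : Measure Ω} {n p : ℕ}
  {M : Matrix (Fin n) (Fin p) ℝ} {X : Ω → Matrix (Fin n) (Fin p) ℝ}

theorem IsNormalMatrixObservation.hasLaw_entries (hX : IsNormalMatrixObservation P M X) :
    HasLaw (fun ω (ij : Fin n × Fin p) => X ω ij.1 ij.2)
      (Measure.pi fun ij : Fin n × Fin p => gaussianReal (M ij.1 ij.2) 1) P :=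
  hX.indep.hasLaw_pi fun ij => hX.hasLaw ij.1 ij.2

theorem isNormalMatrixObservation_of_hasLaw_entries [IsProbabilityMeasure P]
    (hX : HasLaw (fun ω (ij : Fin n × Fin p) => X ω ij.1 ij.2)
      (Measure.pi fun ij : Fin n × Fin p => gaussianReal (M ij.1 ij.2) 1) P) :
    IsNormalMatrixObservation P M X := by
  have h : ∀ ij : Fin n × Fin p,
      HasLaw (fun ω => X ω ij.1 ij.2) (gaussianReal (M ij.1 ij.2) 1) P := fun ij =>
    (measurePreserving_eval (fun ij : Fin n × Fin p => gaussianReal (M ij.1 ij.2) 1)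
      ij).comp_hasLaw hX
  exact ⟨fun i j => h (i, j), (iIndepFun_iff_hasLaw_pi_pi h).2 hX⟩

theorem IsNormalMatrixObservation.mul_mul [IsProbabilityMeasure P]
    (hX : IsNormalMatrixObservation P M X) {O : Matrix (Fin n) (Fin n) ℝ}
    {Q : Matrix (Fin p) (Fin p) ℝ} (hO : O * Oᵀ = 1) (hQ : Qᵀ * Q = 1) :
    IsNormalMatrixObservation P (O * M * Q) fun ω => O * X ω * Q := by
  -- On vectorized matrices, `Y ↦ O Y Q` is the Kronecker product `O ⊗ Qᵀ`, which is orthogonal.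
  have hA : (O ⊗ₖ Qᵀ) * (O ⊗ₖ Qᵀ)ᵀ = 1 := by
    rw [← kroneckerMap_transpose, ← mul_kronecker_mul, hO, transpose_transpose, hQ,
      one_kronecker_one]
  have hvec : ∀ Y : Matrix (Fin n) (Fin p) ℝ, ((O ⊗ₖ Qᵀ) *ᵥ fun ij => Y ij.1 ij.2) =
      fun ij => (O * Y * Q) ij.1 ij.2 := by
    intro Y
    ext ⟨i, j⟩
    simp only [mulVec, dotProduct, kroneckerMap_apply, transpose_apply, Matrix.mul_apply,
      Fintype.sum_prod_type, Finset.sum_mul]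
    rw [Finset.sum_comm]
    exact Finset.sum_congr rfl fun _ _ => Finset.sum_congr rfl fun _ _ => by ring
  have hmeas : Measurable fun x : Fin n × Fin p → ℝ => (O ⊗ₖ Qᵀ) *ᵥ x :=
    (Continuous.matrix_mulVec continuous_const continuous_id).measurable
  have hmap := pi_gaussianReal_map_mulVec (O ⊗ₖ Qᵀ) hA fun ij => M ij.1 ij.2
  rw [hvec] at hmap
  have hlaw : HasLaw (fun x : Fin n × Fin p → ℝ => (O ⊗ₖ Qᵀ) *ᵥ x) _ _ :=
    ⟨hmeas.aemeasurable, hmap⟩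
  have h := hlaw.fun_comp hX.hasLaw_entries
  simp only [hvec] at h
  exact isNormalMatrixObservation_of_hasLaw_entries h

theorem IsNormalMatrixObservation.hasLaw_columns (hX : IsNormalMatrixObservation P M X) :
    HasLaw (fun ω j i => X ω i j)
      (Measure.pi fun j => Measure.pi fun i => gaussianReal (M i j) 1) P := by
  have h := (hX.indep.precomp (Prod.swap_injective (α := Fin p) (β := Fin n))).hasLaw_pi
    fun ji : Fin p × Fin n => hX.hasLaw ji.2 ji.1
  have hmap := Measure.infinitePi_map_curry fun (j : Fin p) (i : Fin n) => gaussianReal (M i j) 1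
  simp only [Measure.infinitePi_eq_pi] at hmap
  have hlaw : HasLaw (MeasurableEquiv.curry (Fin p) (Fin n) ℝ) _ _ :=
    ⟨(MeasurableEquiv.curry (Fin p) (Fin n) ℝ).measurable.aemeasurable, hmap⟩
  exact hlaw.fun_comp h

theorem measurable_mul_inv_gram_apply (i : Fin n) (a : Fin p) :
    Measurable fun C : Fin p → Fin n → ℝ =>
      ((Matrix.of C)ᵀ * ((Matrix.of C) * (Matrix.of C)ᵀ)⁻¹) i a := by
  simp only [Matrix.mul_apply (M := (Matrix.of _)ᵀ)]
  refine Finset.measurable_sum _ fun j _ => Measurable.mul ?_ (measurable_inv_gram_apply j a)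
  simp only [transpose_apply, of_apply]
  fun_prop

theorem estimator_apply (Y : Matrix (Fin n) (Fin p) ℝ) (i : Fin n) (a : Fin p) :
    estimator Y i a = Y i a - ((n : ℝ) - p - 1) * (Y * (Yᵀ * Y)⁻¹) i a := by
  rw [estimator, Matrix.mul_sub, Matrix.mul_one, Matrix.mul_smul, Matrix.sub_apply,
    Matrix.smul_apply, smul_eq_mul]

theorem loss_apply (M M' : Matrix (Fin n) (Fin p) ℝ) (a b : Fin p) :
    loss M M' a b = ∑ i, (M' i a - M i a) * (M' i b - M i b) := by
  simp [loss, Matrix.mul_apply]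

theorem measurable_loss_estimator (M : Matrix (Fin n) (Fin p) ℝ) (a b : Fin p) :
    Measurable fun C : Fin p → Fin n → ℝ => loss M (estimator (Matrix.of C)ᵀ) a b := by
  simp only [loss_apply, estimator_apply, transpose_transpose]
  have h : ∀ (i : Fin n) (a : Fin p), Measurable fun C : Fin p → Fin n → ℝ =>
      (Matrix.of C)ᵀ i a - ((n : ℝ) - p - 1) *
        ((Matrix.of C)ᵀ * ((Matrix.of C) * (Matrix.of C)ᵀ)⁻¹) i a - M i a := fun i a => by
    refine (Measurable.sub ?_ ((measurable_mul_inv_gram_apply i a).const_mul _)).sub_const _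
    simp only [transpose_apply, of_apply]
    fun_prop
  exact Finset.measurable_sum _ fun i _ => (h i a).mul (h i b)

/-- The matrix quadratic risk depends on the observation only through its law. -/
theorem risk_estimator_eq {Ω' : Type*} [MeasurableSpace Ω'] {P' : Measure Ω'}
    {X' : Ω' → Matrix (Fin n) (Fin p) ℝ} (hX : IsNormalMatrixObservation P M X)
    (hX' : IsNormalMatrixObservation P' M X') :
    risk P M X estimator = risk P' M X' estimator := by
  ext a b
  have hf := (measurable_loss_estimator M a b).aestronglyMeasurable
    (μ := Measure.pi fun j => Measure.pi fun i => gaussianReal (M i j) 1)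
  exact (hX.hasLaw_columns.integral_comp hf).trans (hX'.hasLaw_columns.integral_comp hf).symm

/-- A singular Gram matrix has inverse 0 by convention, so the identity needs no invertibility. -/
theorem inv_gram_mul_gram_mul_inv_gram (Y : Matrix (Fin n) (Fin p) ℝ) :
    (Yᵀ * Y)⁻¹ * (Yᵀ * Y) * (Yᵀ * Y)⁻¹ = (Yᵀ * Y)⁻¹ := by
  by_cases h : IsUnit (Yᵀ * Y).det
  · rw [nonsing_inv_mul _ h, one_mul]
  · rw [nonsing_inv_apply_not_isUnit _ h, mul_zero]

/-- With `S = YᵀY`, the Gram matrix of `Y S⁻¹` is `S⁻¹`. A bound on the mean of `S⁻¹ a a` thus gives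
square integrability of the correction term. -/
theorem sum_sq_mul_inv_gram (Y : Matrix (Fin n) (Fin p) ℝ) (a : Fin p) :
    ∑ i, (Y * (Yᵀ * Y)⁻¹) i a ^ 2 = (Yᵀ * Y)⁻¹ a a := by
  have h : (Y * (Yᵀ * Y)⁻¹)ᵀ * (Y * (Yᵀ * Y)⁻¹) = (Yᵀ * Y)⁻¹ := by
    rw [transpose_mul, transpose_nonsing_inv, transpose_mul, transpose_transpose]
    conv_rhs => rw [← inv_gram_mul_gram_mul_inv_gram Y]
    simp only [Matrix.mul_assoc]
  conv_rhs => rw [← h, Matrix.mul_apply]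
  simp only [transpose_apply, sq]

theorem IsNormalMatrixObservation.lintegral_inv_gram_le (hX : IsNormalMatrixObservation P M X)
    (hnp : p + 1 < n) (a : Fin p) :
    ∫⁻ ω, ENNReal.ofReal (((X ω)ᵀ * X ω)⁻¹ a a) ∂P ≤ ENNReal.ofReal (1 / ((n : ℝ) - p - 1)) := by
  cases p with
  | zero => exact a.elim0
  | succ q =>
    have h := lintegral_inv_gram_apply_self_le (by omega) a fun j i => M i j
    rw [← hX.hasLaw_columns.lintegral_comp
      (measurable_inv_gram_apply a a).ennreal_ofReal.aemeasurable] at h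
    refine h.trans_eq ?_
    congr 2
    push_cast
    ring

theorem IsNormalMatrixObservation.lintegral_inv_gram_of_eq_zero
    (hX : IsNormalMatrixObservation P M X) (hnp : p + 1 < n) {a : Fin p} (ha : ∀ i, M i a = 0) :
    ∫⁻ ω, ENNReal.ofReal (((X ω)ᵀ * X ω)⁻¹ a a) ∂P = ENNReal.ofReal (1 / ((n : ℝ) - p - 1)) := by
  cases p with
  | zero => exact a.elim0
  | succ q =>
    have h := lintegral_inv_gram_apply_self_of_eq_zero (by omega) a (fun j i => M i j) (funext ha)
    rw [← hX.hasLaw_columns.lintegral_comp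
      (measurable_inv_gram_apply a a).ennreal_ofReal.aemeasurable] at h
    refine h.trans ?_
    congr 2
    push_cast
    ring

theorem IsNormalMatrixObservation.aemeasurable_inv_gram (hX : IsNormalMatrixObservation P M X)
    (a b : Fin p) : AEMeasurable (fun ω => ((X ω)ᵀ * X ω)⁻¹ a b) P :=
  (measurable_inv_gram_apply a b).comp_aemeasurable hX.hasLaw_columns.aemeasurable

theorem inv_gram_apply_self_nonneg (Y : Matrix (Fin n) (Fin p) ℝ) (a : Fin p) :
    0 ≤ (Yᵀ * Y)⁻¹ a a := by
  rw [← sum_sq_mul_inv_gram]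
  exact Finset.sum_nonneg fun i _ => sq_nonneg _

theorem IsNormalMatrixObservation.integrable_inv_gram (hX : IsNormalMatrixObservation P M X)
    (hnp : p + 1 < n) (a : Fin p) : Integrable (fun ω => ((X ω)ᵀ * X ω)⁻¹ a a) P := by
  rw [← lintegral_ofReal_ne_top_iff_integrable (hX.aemeasurable_inv_gram a a).aestronglyMeasurable
    (Eventually.of_forall fun ω => inv_gram_apply_self_nonneg _ _)]
  exact ((hX.lintegral_inv_gram_le hnp a).trans_lt ENNReal.ofReal_lt_top).ne

theorem IsNormalMatrixObservation.memLp_mul_inv_gram (hX : IsNormalMatrixObservation P M X)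
    (hnp : p + 1 < n) (i : Fin n) (a : Fin p) :
    MemLp (fun ω => (X ω * ((X ω)ᵀ * X ω)⁻¹) i a) 2 P := by
  have hm : AEMeasurable (fun ω => (X ω * ((X ω)ᵀ * X ω)⁻¹) i a) P :=
    (measurable_mul_inv_gram_apply i a).comp_aemeasurable hX.hasLaw_columns.aemeasurable
  rw [memLp_two_iff_integrable_sq hm.aestronglyMeasurable]
  refine (hX.integrable_inv_gram hnp a).mono' (hm.pow_const 2).aestronglyMeasurable
    (Eventually.of_forall fun ω => ?_)
  rw [Real.norm_eq_abs, abs_of_nonneg (sq_nonneg _), ← sum_sq_mul_inv_gram]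
  exact Finset.single_le_sum (f := fun i => (X ω * ((X ω)ᵀ * X ω)⁻¹) i a ^ 2)
    (fun i _ => sq_nonneg _) (Finset.mem_univ i)

theorem IsNormalMatrixObservation.memLp_entry (hX : IsNormalMatrixObservation P M X)
    (i : Fin n) (a : Fin p) : MemLp (fun ω => X ω i a) 2 P := by
  have h := memLp_id_gaussianReal' (μ := M i a) (v := 1) 2 (by simp)
  rw [← (hX.hasLaw i a).map_eq] at h
  exact h.comp_of_map (hX.hasLaw i a).aemeasurable

theorem IsNormalMatrixObservation.integrable_loss [IsProbabilityMeasure P]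
    (hX : IsNormalMatrixObservation P M X) (hnp : p + 1 < n) (a b : Fin p) :
    Integrable (fun ω => loss M (estimator (X ω)) a b) P := by
  have h : ∀ i a, MemLp (fun ω => estimator (X ω) i a - M i a) 2 P := fun i a => by
    simp only [estimator_apply]
    exact ((hX.memLp_entry i a).sub ((hX.memLp_mul_inv_gram hnp i a).const_mul _)).sub
      (memLp_const _)
  simp only [loss_apply]
  exact integrable_finsetSum _ fun i _ => (h i a).integrable_mul (h i b)

theorem IsNormalMatrixObservation.ae_isUnit_det_gram (hX : IsNormalMatrixObservation P M X)
    (hnp : p + 1 < n) : ∀ᵐ ω ∂P, IsUnit ((X ω)ᵀ * X ω).det := by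
  have h := ae_linearIndependent hnp fun j i => M i j
  rw [← hX.hasLaw_columns.map_eq] at h
  filter_upwards [ae_of_ae_map hX.hasLaw_columns.aemeasurable h] with ω hω
  exact (isUnit_iff_isUnit_det _).1 (isUnit_mul_transpose_self (C := (X ω)ᵀ) hω)

theorem IsNormalMatrixObservation.integral_sq_of_eq_zero [IsProbabilityMeasure P]
    (hX : IsNormalMatrixObservation P M X) {i : Fin n} {a : Fin p} (h0 : M i a = 0) :
    ∫ ω, X ω i a ^ 2 ∂P = 1 := by
  have h := hX.hasLaw i a
  have hv := h.variance_eq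
  have hm := h.integral_eq
  rw [h0, integral_id_gaussianReal] at hm
  rw [variance_of_integral_eq_zero h.aemeasurable hm, variance_id_gaussianReal] at hv
  simpa using hv

theorem IsNormalMatrixObservation.risk_apply_self_of_eq_zero [IsProbabilityMeasure P]
    (hX : IsNormalMatrixObservation P M X) (hnp : p + 1 < n) {a : Fin p} (ha : ∀ i, M i a = 0) :
    risk P M X estimator a a = (p : ℝ) + 1 := by
  have hc : (0 : ℝ) < (n : ℝ) - p - 1 := by
    have : ((p + 1 : ℕ) : ℝ) < n := by exact_mod_cast hnp
    push_cast at this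
    linarith
  set c : ℝ := (n : ℝ) - p - 1 with hcdef
  have hloss : (fun ω => loss M (estimator (X ω)) a a) =ᵐ[P]
      fun ω => (∑ i, X ω i a ^ 2 - 2 * c) + c ^ 2 * ((X ω)ᵀ * X ω)⁻¹ a a := by
    filter_upwards [hX.ae_isUnit_det_gram hnp] with ω hω
    -- The cross term is a diagonal entry of `XᵀX (XᵀX)⁻¹ = 1`; this is where almost sure
    -- invertibility is used.
    have h1 : ∑ i, X ω i a * (X ω * ((X ω)ᵀ * X ω)⁻¹) i a = 1 := by
      have : ((X ω)ᵀ * (X ω * ((X ω)ᵀ * X ω)⁻¹)) a a = 1 := by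
        rw [← Matrix.mul_assoc, mul_nonsing_inv _ hω, one_apply_eq]
      rw [Matrix.mul_apply] at this
      exact this
    rw [← sum_sq_mul_inv_gram]
    simp only [loss_apply, estimator_apply, ha, sub_zero, ← hcdef]
    calc _ = ∑ i, X ω i a ^ 2 - 2 * c * ∑ i, X ω i a * (X ω * ((X ω)ᵀ * X ω)⁻¹) i a +
          c ^ 2 * ∑ i, (X ω * ((X ω)ᵀ * X ω)⁻¹) i a ^ 2 := by
          simp only [Finset.mul_sum, ← Finset.sum_sub_distrib, ← Finset.sum_add_distrib]
          exact Finset.sum_congr rfl fun i _ => by ring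
      _ = _ := by rw [h1, mul_one]
  have hsq : ∀ i, Integrable (fun ω => X ω i a ^ 2) P := fun i => (hX.memLp_entry i a).integrable_sq
  have hsum : Integrable (fun ω => ∑ i, X ω i a ^ 2) P := integrable_finsetSum _ fun i _ => hsq i
  have hinv : ∫ ω, ((X ω)ᵀ * X ω)⁻¹ a a ∂P = 1 / c := by
    rw [integral_eq_lintegral_of_nonneg_ae
      (Eventually.of_forall fun ω => inv_gram_apply_self_nonneg _ _)
      (hX.aemeasurable_inv_gram a a).aestronglyMeasurable,
      hX.lintegral_inv_gram_of_eq_zero hnp ha, ENNReal.toReal_ofReal (by positivity)]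
  have hdiff : Integrable (fun ω => ∑ i, X ω i a ^ 2 - 2 * c) P := hsum.sub (integrable_const _)
  rw [risk, of_apply, integral_congr_ae hloss, integral_add hdiff
    ((hX.integrable_inv_gram hnp a).const_mul _),
    integral_sub hsum (integrable_const _), integral_const_mul (c ^ 2), hinv,
    integral_finsetSum _ fun i _ => hsq i]
  simp only [hX.integral_sq_of_eq_zero (ha _)]
  simp
  field_simp
  rw [hcdef]
  ring

theorem estimator_mul_mul {O : Matrix (Fin n) (Fin n) ℝ} {Q : Matrix (Fin p) (Fin p) ℝ}
    (hO : Oᵀ * O = 1) (hQ : Qᵀ * Q = 1) (Y : Matrix (Fin n) (Fin p) ℝ) :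
    estimator (O * Y * Q) = O * estimator Y * Q := by
  have hQ' : Q * Qᵀ = 1 := mul_eq_one_comm.1 hQ
  have hS : (O * Y * Q)ᵀ * (O * Y * Q) = Qᵀ * (Yᵀ * Y) * Q := by
    calc _ = Qᵀ * (Yᵀ * (Oᵀ * O) * Y) * Q := by
          simp only [transpose_mul, Matrix.mul_assoc]
      _ = _ := by rw [hO, Matrix.mul_one]
  have hinv : (Qᵀ * (Yᵀ * Y) * Q)⁻¹ = Qᵀ * (Yᵀ * Y)⁻¹ * Q := by
    rw [Matrix.mul_inv_rev, Matrix.mul_inv_rev, inv_eq_left_inv hQ, inv_eq_left_inv hQ',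
      ← Matrix.mul_assoc]
  rw [estimator, hS, hinv, estimator]
  simp only [Matrix.mul_sub, Matrix.sub_mul, Matrix.mul_one, Matrix.mul_smul, Matrix.smul_mul]
  congr 2
  calc _ = O * Y * (Q * Qᵀ) * (Yᵀ * Y)⁻¹ * Q := by simp only [Matrix.mul_assoc]
    _ = _ := by rw [hQ', Matrix.mul_one]; simp only [Matrix.mul_assoc]

theorem loss_mul_mul {O : Matrix (Fin n) (Fin n) ℝ} (hO : Oᵀ * O = 1)
    (Q : Matrix (Fin p) (Fin p) ℝ) (M M' : Matrix (Fin n) (Fin p) ℝ) :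
    loss (O * M * Q) (O * M' * Q) = Qᵀ * loss M M' * Q := by
  have h : O * M' * Q - O * M * Q = O * (M' - M) * Q := by
    rw [Matrix.mul_sub, Matrix.sub_mul]
  rw [loss, h]
  calc _ = Qᵀ * ((M' - M)ᵀ * (Oᵀ * O) * (M' - M)) * Q := by
        simp only [transpose_mul, Matrix.mul_assoc]
    _ = _ := by rw [hO, Matrix.mul_one]; rfl

theorem IsNormalMatrixObservation.risk_mul_mul [IsProbabilityMeasure P]
    (hX : IsNormalMatrixObservation P M X) (hnp : p + 1 < n) {O : Matrix (Fin n) (Fin n) ℝ}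
    {Q : Matrix (Fin p) (Fin p) ℝ} (hO : Oᵀ * O = 1) (hQ : Qᵀ * Q = 1) :
    risk P (O * M * Q) (fun ω => O * X ω * Q) estimator = Qᵀ * risk P M X estimator * Q := by
  ext a b
  simp only [risk, of_apply, estimator_mul_mul hO hQ, loss_mul_mul hO]
  simp only [Matrix.mul_apply, of_apply]
  rw [integral_finsetSum]
  · refine Finset.sum_congr rfl fun j _ => ?_
    rw [integral_mul_const, integral_finsetSum]
    · simp only [integral_const_mul]
    · exact fun i _ => (hX.integrable_loss hnp i j).const_mul _
  · exact fun j _ => (integrable_finsetSum _ fun i _ =>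
      (hX.integrable_loss hnp i j).const_mul _).mul_const _

end Observation

/-! ### Householder reflections -/

section Householder

variable {m : Type*} [Fintype m] [DecidableEq m]

/-- The matrix of the reflection in the hyperplane orthogonal to `w`. -/
noncomputable def householder (w : m → ℝ) : Matrix m m ℝ :=
  1 - (2 / (w ⬝ᵥ w)) • vecMulVec w w

theorem householder_transpose (w : m → ℝ) : (householder w)ᵀ = householder w := by
  rw [householder, transpose_sub, transpose_one, transpose_smul, transpose_vecMulVec]

theorem householder_mulVec (w x : m → ℝ) :
    householder w *ᵥ x = x - (2 / (w ⬝ᵥ w) * (w ⬝ᵥ x)) • w := by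
  rw [householder, sub_mulVec, one_mulVec, smul_mulVec, vecMulVec_mulVec]
  ext i
  simp only [Pi.sub_apply, Pi.smul_apply, MulOpposite.smul_eq_mul_unop, MulOpposite.unop_op,
    smul_eq_mul]
  ring

theorem householder_transpose_mul_self (w : m → ℝ) : (householder w)ᵀ * householder w = 1 := by
  rw [householder_transpose]
  -- For `w = 0` division by zero makes the reflection the identity, a case needed later for `w = M
  -- u = 0`.
  by_cases h : w ⬝ᵥ w = 0
  · simp [householder, h]
  · simp only [householder, Matrix.mul_sub, Matrix.sub_mul, Matrix.mul_one, Matrix.one_mul,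
      Matrix.mul_smul, Matrix.smul_mul, vecMulVec_mul_vecMulVec]
    ext i j
    simp [vecMulVec_apply]
    field_simp
    ring

theorem householder_mulVec_self {w : m → ℝ} (hw : w ≠ 0) : householder w *ᵥ w = -w := by
  have h : w ⬝ᵥ w ≠ 0 := fun h => hw (dotProduct_self_eq_zero.1 h)
  rw [householder_mulVec, div_mul_cancel₀ _ h, two_smul]
  abel

theorem eq_smul_of_householder_mulVec_eq_neg {w y : m → ℝ} (h : householder w *ᵥ y = -y) :
    y = (w ⬝ᵥ y / (w ⬝ᵥ w)) • w := by
  rw [householder_mulVec] at h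
  ext i
  have := congrFun h i
  simp only [Pi.sub_apply, Pi.smul_apply, Pi.neg_apply, smul_eq_mul] at this ⊢
  linear_combination this / 2

theorem householder_sub_mulVec {x y : m → ℝ} (hx : x ⬝ᵥ x = 1) (hy : y ⬝ᵥ y = 1) :
    householder (x - y) *ᵥ y = x := by
  by_cases h : x - y = 0
  · rw [sub_eq_zero.1 h]; simp [householder]
  · have h0 : (x - y) ⬝ᵥ (x - y) ≠ 0 := fun h' => h (dotProduct_self_eq_zero.1 h')
    have h1 : (x - y) ⬝ᵥ (x - y) = -2 * ((x - y) ⬝ᵥ y) := by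
      simp only [sub_dotProduct, dotProduct_sub, hx, hy, dotProduct_comm y x]
      ring
    have h2 : 2 / ((x - y) ⬝ᵥ (x - y)) * ((x - y) ⬝ᵥ y) = -1 := by
      rw [div_mul_eq_mul_div, div_eq_iff h0, h1]; ring
    rw [householder_mulVec, h2]
    simp

/-- Since `Mᵀ(M u) = c u` and `|M u|² = c |u|²`, the rank-one corrections on the two sides of `M`
agree: the factor `c` cancels, or `M u = 0` and both vanish. So `M` intertwines the two reflections.
-/
theorem householder_mul_mul_householder {l : Type*} [Fintype l] [DecidableEq l]
    {M : Matrix l m ℝ} {u : m → ℝ} (hu : u ≠ 0) {c : ℝ} (h : (Mᵀ * M) *ᵥ u = c • u) :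
    householder (M *ᵥ u) * M * householder u = M := by
  have huu : u ⬝ᵥ u ≠ 0 := fun h => hu (dotProduct_self_eq_zero.1 h)
  have hvec : (M *ᵥ u) ᵥ* M = c • u := by
    rw [← mulVec_transpose, mulVec_mulVec, h]
  have hdot : (M *ᵥ u) ⬝ᵥ (M *ᵥ u) = c * (u ⬝ᵥ u) := by
    rw [dotProduct_mulVec, hvec, smul_dotProduct, smul_eq_mul]
  have hcomm : householder (M *ᵥ u) * M = M * householder u := by
    simp only [householder, Matrix.sub_mul, Matrix.mul_sub, Matrix.one_mul, Matrix.mul_one,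
      Matrix.smul_mul, Matrix.mul_smul, vecMulVec_mul, mul_vecMulVec, hvec, hdot]
    congr 1
    by_cases hc : c = 0
    · have : M *ᵥ u = 0 := dotProduct_self_eq_zero.1 (by rw [hdot, hc, zero_mul])
      simp [this]
    · ext i j
      simp [vecMulVec_apply]
      field_simp
  rw [hcomm, Matrix.mul_assoc]
  nth_rewrite 1 [← householder_transpose u]
  rw [householder_transpose_mul_self, Matrix.mul_one]

end Householder

/-! ### Eigenvectors and eigenvalues of the risk -/

section Eigenvectors

variable {Ω : Type*} [MeasurableSpace Ω] {P : Measure Ω} [IsProbabilityMeasure P] {n p : ℕ}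
  {M : Matrix (Fin n) (Fin p) ℝ} {X : Ω → Matrix (Fin n) (Fin p) ℝ}

theorem IsNormalMatrixObservation.exists_risk_mulVec_eq (hX : IsNormalMatrixObservation P M X)
    (hnp : p + 1 < n) {u : Fin p → ℝ} (hu : u ≠ 0) {c : ℝ} (h : (Mᵀ * M) *ᵥ u = c • u) :
    ∃ r : ℝ, risk P M X estimator *ᵥ u = r • u := by
  have hO := householder_transpose_mul_self (M *ᵥ u)
  have hQ := householder_transpose_mul_self u
  have hM := householder_mul_mul_householder hu h
  have hX' := hX.mul_mul (mul_eq_one_comm.1 hO) hQ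
  have hR := hX.risk_mul_mul hnp hO hQ
  rw [hM] at hX' hR
  rw [← risk_estimator_eq hX hX'] at hR
  set R := risk P M X estimator
  rw [householder_transpose] at hQ hR
  have hcomm : householder u * R = R * householder u := by
    calc householder u * R = householder u * (householder u * R * householder u) := by rw [← hR]
      _ = householder u * householder u * R * householder u := by simp only [Matrix.mul_assoc]
      _ = _ := by rw [hQ, Matrix.one_mul]
  -- `R u` is negated by the reflection along `u`, hence is a multiple of `u`.
  refine ⟨_, eq_smul_of_householder_mulVec_eq_neg (w := u) ?_⟩
  rw [mulVec_mulVec, hcomm, ← mulVec_mulVec, householder_mulVec_self hu, mulVec_neg]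

theorem IsNormalMatrixObservation.dotProduct_risk_mulVec_of_mulVec_eq_zero
    (hX : IsNormalMatrixObservation P M X) (hnp : p + 1 < n) {u : Fin p → ℝ}
    (hu : u ⬝ᵥ u = 1) (h : M *ᵥ u = 0) :
    u ⬝ᵥ (risk P M X estimator *ᵥ u) = (p : ℝ) + 1 := by
  obtain ⟨a⟩ : Nonempty (Fin p) := by
    by_contra hne
    rw [not_nonempty_iff] at hne
    simp [dotProduct] at hu
  set e : Fin p → ℝ := Pi.single a 1 with he
  -- Reflecting along `u - e` exchanges the unit vectors, so column `a` of `M Q` is `M u = 0`.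
  have hQe : householder (u - e) *ᵥ e = u := householder_sub_mulVec hu (by simp [he])
  have hQ := householder_transpose_mul_self (u - e)
  set Q := householder (u - e)
  have hX' := hX.mul_mul (O := 1) (by simp) hQ
  have hcol : ∀ i, ((1 : Matrix (Fin n) (Fin n) ℝ) * M * Q) i a = 0 := fun i => by
    have : ((1 : Matrix (Fin n) (Fin n) ℝ) * M * Q) *ᵥ e = 0 := by
      rw [Matrix.one_mul, ← mulVec_mulVec, hQe, h]
    have := congrFun this i
    rwa [he, mulVec_single_one] at this
  have hval := hX'.risk_apply_self_of_eq_zero hnp hcol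
  rw [hX.risk_mul_mul hnp (by simp) hQ] at hval
  rw [← hval]
  have hent : (Qᵀ * risk P M X estimator * Q) a a =
      e ⬝ᵥ ((Qᵀ * risk P M X estimator * Q) *ᵥ e) := by
    simp [he]
  rw [hent, ← mulVec_mulVec, ← mulVec_mulVec, hQe, dotProduct_mulVec e, vecMul_transpose, hQe]

theorem IsNormalMatrixObservation.exists_risk_eigenvalue (hX : IsNormalMatrixObservation P M X)
    (hnp : p + 1 < n) {v : Fin p → ℝ} (hv : v ≠ 0) {c : ℝ} (h : (Mᵀ * M) *ᵥ v = c • v) :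
    ∃ r : ℝ, risk P M X estimator *ᵥ v = r • v ∧ (c = 0 → r = (p : ℝ) + 1) := by
  obtain ⟨r, hr⟩ := hX.exists_risk_mulVec_eq hnp hv h
  refine ⟨r, hr, fun hc => ?_⟩
  have hvv : 0 < v ⬝ᵥ v :=
    lt_of_le_of_ne (Finset.sum_nonneg fun i _ => mul_self_nonneg _)
      fun h => hv (dotProduct_self_eq_zero.1 h.symm)
  have hMv : M *ᵥ v = 0 := by
    refine dotProduct_self_eq_zero.1 ?_
    rw [dotProduct_mulVec, ← mulVec_transpose, mulVec_mulVec, h, hc, zero_smul, zero_dotProduct]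
  -- Normalizes `v`, so that the quadratic form of the risk at `t • v` is exactly `r`.
  set t : ℝ := (√(v ⬝ᵥ v))⁻¹ with ht
  have htt : t * (t * (v ⬝ᵥ v)) = 1 := by
    have hs : √(v ⬝ᵥ v) * √(v ⬝ᵥ v) = v ⬝ᵥ v := Real.mul_self_sqrt hvv.le
    have hs0 : √(v ⬝ᵥ v) ≠ 0 := (Real.sqrt_pos.2 hvv).ne'
    calc t * (t * (v ⬝ᵥ v)) = (t * √(v ⬝ᵥ v)) * (t * √(v ⬝ᵥ v)) := by
          linear_combination -t ^ 2 * hs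
      _ = 1 := by rw [ht, inv_mul_cancel₀ hs0, one_mul]
  have huu : (t • v) ⬝ᵥ (t • v) = 1 := by
    simpa only [smul_dotProduct, dotProduct_smul, smul_eq_mul] using htt
  have hval := hX.dotProduct_risk_mulVec_of_mulVec_eq_zero hnp huu
    (by rw [mulVec_smul, hMv, smul_zero])
  rw [← hval, mulVec_smul, hr]
  simp only [smul_dotProduct, dotProduct_smul, smul_eq_mul]
  linear_combination -r * htt

end Eigenvectors

end EfronMorris

theorem mainTheorem5 {Ω : Type*} [MeasurableSpace Ω] (P : Measure Ω) [IsProbabilityMeasure P]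
    {n p : ℕ} (hnp : p + 1 < n) (M : Matrix (Fin n) (Fin p) ℝ)
    (X : Ω → Matrix (Fin n) (Fin p) ℝ)
    (hX : EfronMorris.IsNormalMatrixObservation P M X) :
    -- the risk is finite
    (∀ a b, Integrable (fun ω => EfronMorris.loss M (EfronMorris.estimator (X ω)) a b) P) ∧
    -- every spectral decomposition of `MᵀM` diagonalizes the risk with the same eigenvectors,
    -- and the eigenvalue of the risk that corresponds to a zero eigenvalue of `MᵀM` is `p + 1`
    (∀ U ∈ Matrix.orthogonalGroup (Fin p) ℝ, ∀ l : Fin p → ℝ,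
      Mᵀ * M = Uᵀ * Matrix.diagonal l * U →
      ∃ r : Fin p → ℝ,
        EfronMorris.risk P M X EfronMorris.estimator = Uᵀ * Matrix.diagonal r * U ∧
        ∀ j, l j = 0 → r j = (p : ℝ) + 1) ∧
    -- the same for single eigenvectors
    (∀ (l : ℝ) (v : Fin p → ℝ),
      Module.End.HasEigenvector (Matrix.toLin' (Mᵀ * M)) l v →
      ∃ r : ℝ,
        Module.End.HasEigenvector
          (Matrix.toLin' (EfronMorris.risk P M X EfronMorris.estimator)) r v ∧
        (l = 0 → r = (p : ℝ) + 1)) := by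
  refine ⟨hX.integrable_loss hnp, fun U hU l hl => ?_, fun l v hv => ?_⟩
  · have hUU : U * Uᵀ = 1 := (mem_orthogonalGroup_iff (Fin p) ℝ).1 hU
    have hUU' : Uᵀ * U = 1 := mul_eq_one_comm.1 hUU
    -- The eigenvectors in `Uᵀ Λ U` are the rows of `U`.
    have hcol : ∀ j, Uᵀ *ᵥ Pi.single j 1 = U j := fun j => by rw [mulVec_single_one]; rfl
    have hne : ∀ j, U j ≠ 0 := fun j hj => by
      have := congrFun (congrFun hUU j) j
      rw [Matrix.mul_apply] at this
      simp [hj] at this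
    have heig : ∀ j, (Mᵀ * M) *ᵥ U j = l j • U j := fun j => by
      rw [hl, ← hcol j, mulVec_mulVec, Matrix.mul_assoc, hUU, Matrix.mul_one, ← mulVec_mulVec,
        diagonal_mulVec_single, mul_one, ← mulVec_smul]
      congr 1
      rw [← Pi.single_smul', smul_eq_mul, mul_one]
    choose r hr hr0 using fun j => hX.exists_risk_eigenvalue hnp (hne j) (heig j)
    refine ⟨r, ?_, hr0⟩
    have hRU : EfronMorris.risk P M X EfronMorris.estimator * Uᵀ = Uᵀ * Matrix.diagonal r := by
      ext i j
      have := congrFun (hr j) i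
      rw [mul_diagonal]
      simpa [mulVec, dotProduct, Matrix.mul_apply, mul_comm] using this
    rw [← hRU, Matrix.mul_assoc, hUU', Matrix.mul_one]
  · obtain ⟨r, hr, hr0⟩ := hX.exists_risk_eigenvalue hnp hv.2
      (by simpa [toLin'_apply] using hv.apply_eq_smul)
    refine ⟨r, Module.End.hasEigenvector_iff.2 ⟨Module.End.mem_eigenspace_iff.2 ?_, hv.2⟩, hr0⟩
    rw [toLin'_apply, hr]
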